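/- \textbf{Theorem 1} (one-dimensional flat chain conjecture). Let $d\ge 0$ and let $T$ be a metric $1$-current (of finite mass) in $\mathbb{R}^d$, that is, a bilinear map $(f,\pi)\mapsto T(f,\pi)\in\mathbb{R}$, where $f$ ranges over the bounded Borel functions and $\pi$ over the real-valued Lipschitz functions on $\mathbb{R}^d$, such that: (locality) $T(f,\pi)=0$ whenever $\pi$ is constant on $\{f\neq 0\}$; (continuity) $T(f,\pi_n)\to T(f,\pi)$ whenever $\pi_n\to\pi$ pointwise with $\sup_n\operatorname{Lip}\pi_n<\infty$; (finite mass) there is a finite Borel measure $\mu$ on $\mathbb{R}^d$ with $|T(f,\pi)|\le \operatorname{Lip}(\pi)\int|f|\,d\mu$ for all $(f,\pi)$. Then the associated de Rham current $$\mathbf{T}\Big(\sum_{k=1}^d f_k\,dx_k\Big)=\sum_{k=1}^d T(f_k,x_k),$$ a continuous linear functional on the smooth compactly supported $1$-forms on $\mathbb{R}^d$, is a flat $1$-chain of finite mass. Here, for a de Rham $m$-current $\mathbf{S}$, with $\|\cdot\|$ the comass norm and $\omega$ ranging over smooth compactly supported $m$-forms, the mass is $\mathbf{M}(\mathbf{S})=\sup\{\mathbf{S}(\omega):\|\omega(x)\|\le1\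 \forall x\}$, the flat norm is $\mathbf{F}(\mathbf{S})=\sup\{\mathbf{S}(\omega):\|\omega(x)\|\le1,\ \|d\omega(x)\|\le1\ \forall x\}$, and $\partial\mathbf{S}(\omega)=\mathbf{S}(d\omega)$. A de Rham $1$-current $\mathbf{S}$ is normal if $\mathbf{M}(\mathbf{S})+\mathbf{M}(\partial\mathbf{S})<\infty$, and $\mathbf{S}$ is a flat $1$-chain if there are normal $1$-currents $\mathbf{S}_n$ with $\mathbf{F}(\mathbf{S}_n-\mathbf{S})\to0$. Compact support is required neither of normal currents nor of flat chains. -/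

import Mathlib

open MeasureTheory Filter Topology
open scoped NNReal ENNReal Distributions

/-! ### Metric `1`-currents -/

/-- The linear space of bounded Borel functions on `E`. -/
def BoundedBorel (E : Type*) [MeasurableSpace E] : Submodule ℝ (E → ℝ) where
  carrier := {f | Measurable f ∧ ∃ C : ℝ, ∀ x, |f x| ≤ C}
  add_mem' := by
    rintro f g ⟨hf, C, hC⟩ ⟨hg, D, hD⟩
    exact ⟨hf.add hg, C + D, fun x => (abs_add_le _ _).trans (add_le_add (hC x) (hD x))⟩
  zero_mem' := ⟨measurable_const, 0, fun x => by simp⟩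
  smul_mem' := by
    rintro c f ⟨hf, C, hC⟩
    refine ⟨hf.const_smul c, |c| * C, fun x => ?_⟩
    simpa [abs_mul] using mul_le_mul_of_nonneg_left (hC x) (abs_nonneg c)

/-- The linear space of (not necessarily bounded) real Lipschitz functions on `E`. -/
def LipFun (E : Type*) [MetricSpace E] : Submodule ℝ (E → ℝ) where
  carrier := {π | ∃ K : ℝ≥0, LipschitzWith K π}
  add_mem' := by
    rintro f g ⟨K, hK⟩ ⟨L, hL⟩
    exact ⟨K + L, hK.add hL⟩
  zero_mem' := ⟨0, LipschitzWith.const 0⟩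
  smul_mem' := by
    rintro c f ⟨K, hK⟩
    exact ⟨‖c‖₊ * K, (lipschitzWith_smul c).comp hK⟩

/-- The (best) Lipschitz constant of a Lipschitz function. -/
noncomputable def lipConst {E : Type*} [MetricSpace E] (π : LipFun E) : ℝ≥0 :=
  sInf {K : ℝ≥0 | LipschitzWith K (π : E → ℝ)}

/-- A metric `1`-current of finite mass (in the sense of Ambrosio and Kirchheim) in the metric
space `E`, equipped with its Borel `σ`-algebra. -/
structure MetricOneCurrent (E : Type*) [MetricSpace E] [MeasurableSpace E] [BorelSpace E] where
  /-- the underlying bilinear functional -/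
  toBilin : BoundedBorel E →ₗ[ℝ] LipFun E →ₗ[ℝ] ℝ
  locality : ∀ (f : BoundedBorel E) (π : LipFun E),
    (∃ c : ℝ, ∀ x : E, (f : E → ℝ) x ≠ 0 → (π : E → ℝ) x = c) → toBilin f π = 0
  continuity : ∀ (f : BoundedBorel E) (πs : ℕ → LipFun E) (π : LipFun E),
    (∃ K : ℝ≥0, ∀ n, lipConst (πs n) ≤ K) →
    (∀ x : E, Tendsto (fun n => (πs n : E → ℝ) x) atTop (𝓝 ((π : E → ℝ) x))) →
    Tendsto (fun n => toBilin f (πs n)) atTop (𝓝 (toBilin f π))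
  finite_mass : ∃ μ : Measure E, IsFiniteMeasure μ ∧
    ∀ (f : BoundedBorel E) (π : LipFun E),
      |toBilin f π| ≤ lipConst π * ∫ x, |(f : E → ℝ) x| ∂μ

/-! ### de Rham currents in `ℝ^d` -/

/-- Compactly supported smooth differential `m`-forms on `ℝ^d`, with the usual locally convex
inductive limit topology. The pointwise norm `‖ω x‖` is the operator norm of an alternating map
on Euclidean space, which is the comass norm: every simple unit `m`-vector is the exterior product
of an orthonormal family, and `|v₁ ∧ ⋯ ∧ vₘ| ≤ |v₁| ⋯ |vₘ|`. -/
abbrev DForm (d m : ℕ) : Type :=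
  𝓓((⊤ : TopologicalSpace.Opens (EuclideanSpace ℝ (Fin d))),
    EuclideanSpace ℝ (Fin d) [⋀^Fin m]→L[ℝ] ℝ)

/-- de Rham `m`-currents in `ℝ^d`. -/
abbrev DRCurrent (d m : ℕ) : Type := DForm d m →L[ℝ] ℝ

/-- The exterior derivative, as a continuous linear map on compactly supported smooth forms. -/
noncomputable def DForm.dCLM (d m : ℕ) : DForm d m →L[ℝ] DForm d (m + 1) :=
  (TestFunction.postcompCLM (ContinuousAlternatingMap.alternatizeUncurryFinCLM ℝ
      (EuclideanSpace ℝ (Fin d)) ℝ)).comp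
    (TestFunction.fderivCLM ℝ ⊤ ⊤)

theorem DForm.dCLM_apply {d m : ℕ} (ω : DForm d m) (x : EuclideanSpace ℝ (Fin d)) :
    DForm.dCLM d m ω x = extDeriv (fun y => ω y) x := by
  have h := TestFunction.fderivCLM_apply_of_le (𝕜 := ℝ) (k := ⊤) ω (by simp)
  change ContinuousAlternatingMap.alternatizeUncurryFinCLM ℝ _ ℝ
    (TestFunction.fderivCLM ℝ ⊤ ⊤ ω x) = _
  rw [h]
  rfl

/-- The boundary of a de Rham current: `∂T(ω) = T(dω)`. -/
noncomputable def DRCurrent.boundary {d m : ℕ} (T : DRCurrent d (m + 1)) : DRCurrent d m :=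
  T.comp (DForm.dCLM d m)

/-- The mass of a de Rham current. -/
noncomputable def DRCurrent.mass {d m : ℕ} (T : DRCurrent d m) : ℝ≥0∞ :=
  ⨆ (ω : DForm d m) (_ : ∀ x, ‖ω x‖ ≤ 1), ENNReal.ofReal (T ω)

/-- The flat norm of a de Rham current. -/
noncomputable def DRCurrent.flatNorm {d m : ℕ} (T : DRCurrent d m) : ℝ≥0∞ :=
  ⨆ (ω : DForm d m) (_ : ∀ x, ‖ω x‖ ≤ 1 ∧ ‖DForm.dCLM d m ω x‖ ≤ 1), ENNReal.ofReal (T ω)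

/-- Federer-Fleming normal currents (not necessarily compactly supported). -/
def DRCurrent.IsNormal {d : ℕ} : {m : ℕ} → DRCurrent d m → Prop
  | 0, T => T.mass < ∞
  | _ + 1, T => T.mass + (DRCurrent.boundary T).mass < ∞

/-- Flat chains (not necessarily compactly supported): limits of normal currents with respect to
the flat norm. -/
def DRCurrent.IsFlatChain {d m : ℕ} (T : DRCurrent d m) : Prop :=
  ∃ S : ℕ → DRCurrent d m, (∀ n, (S n).IsNormal) ∧
    Tendsto (fun n => DRCurrent.flatNorm (S n - T)) atTop (𝓝 0)

/-! ### The de Rham current associated with a metric current -/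

/-- The `k`-th coefficient of the `1`-form `ω = ∑ k, ω_k dx_k`, as a bounded Borel function. -/
noncomputable def DForm.coeff {d : ℕ} (ω : DForm d 1) (k : Fin d) :
    BoundedBorel (EuclideanSpace ℝ (Fin d)) :=
  ⟨fun x => ω x (fun _ => EuclideanSpace.single k 1), by
    constructor
    · have h : Continuous fun x => ω x (fun _ => EuclideanSpace.single k (1 : ℝ)) :=
        (ContinuousAlternatingMap.apply ℝ _ ℝ
          (fun _ : Fin 1 => EuclideanSpace.single k (1 : ℝ))).continuous.comp ω.continuous
      exact h.measurable
    · refine ⟨‖TestFunction.toBoundedContinuousFunctionCLM ℝ ω‖, fun x => ?_⟩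
      have h1 := (ω x).le_opNorm (fun _ => EuclideanSpace.single k (1 : ℝ))
      have h2 := (TestFunction.toBoundedContinuousFunctionCLM ℝ ω).norm_coe_le_norm x
      simp only [Finset.univ_unique, Finset.prod_const, Finset.card_singleton, pow_one,
        PiLp.norm_single, norm_one, mul_one, Real.norm_eq_abs] at h1
      exact h1.trans h2⟩

/-- The `k`-th coordinate function on `ℝ^d`. -/
def coordFun {d : ℕ} (k : Fin d) : LipFun (EuclideanSpace ℝ (Fin d)) :=
  ⟨fun x => x k, 1, LipschitzWith.of_dist_le_mul fun x y => by
    simpa [dist_eq_norm] using PiLp.norm_apply_le (x - y) k⟩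

/-- The de Rham current associated with a metric `1`-current `T` in `ℝ^d`:
`∑ k, f_k dx_k ↦ ∑ k, T(f_k, x_k)`. -/
noncomputable def MetricOneCurrent.toDeRham {d : ℕ}
    (T : MetricOneCurrent (EuclideanSpace ℝ (Fin d))) :
    DRCurrent d 1 where
  toFun ω := ∑ k : Fin d, T.toBilin (ω.coeff k) (coordFun k)
  map_add' ω η := by
    rw [← Finset.sum_add_distrib]
    refine Finset.sum_congr rfl fun k _ => ?_
    rw [← LinearMap.add_apply, ← map_add]
    rfl
  map_smul' c ω := by
    rw [RingHom.id_apply, Finset.smul_sum]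
    refine Finset.sum_congr rfl fun k _ => ?_
    rw [← LinearMap.smul_apply, ← map_smul]
    rfl
  cont := by
    obtain ⟨μ, hμ, hT⟩ := T.finite_mass
    refine continuous_finsetSum _ fun k _ => ?_
    let Φ : DForm d 1 →+ ℝ :=
      { toFun := fun ω => T.toBilin (ω.coeff k) (coordFun k)
        map_zero' := by
          have : (0 : DForm d 1).coeff k = 0 := rfl
          rw [this, map_zero, LinearMap.zero_apply]
        map_add' := fun ω η => by
          rw [← LinearMap.add_apply, ← map_add]
          rfl }
    change Continuous Φ
    refine continuous_of_continuousAt_zero Φ ?_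
    have hb : ∀ ω : DForm d 1, ‖Φ ω‖ ≤ lipConst (coordFun k) *
        (‖TestFunction.toBoundedContinuousFunctionCLM ℝ ω‖ * μ.real Set.univ) := fun ω => by
      refine (hT (ω.coeff k) (coordFun k)).trans ?_
      refine mul_le_mul_of_nonneg_left ?_ NNReal.zero_le_coe
      have := norm_integral_le_of_norm_le_const (μ := μ)
        (f := fun x => |(ω.coeff k : EuclideanSpace ℝ (Fin d) → ℝ) x|)
        (C := ‖TestFunction.toBoundedContinuousFunctionCLM ℝ ω‖)
        (Eventually.of_forall fun x => by
          have h1 := (ω x).le_opNorm (fun _ => EuclideanSpace.single k (1 : ℝ))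
          have h2 := (TestFunction.toBoundedContinuousFunctionCLM ℝ ω).norm_coe_le_norm x
          simp only [Finset.univ_unique, Finset.prod_const, Finset.card_singleton, pow_one,
            PiLp.norm_single, norm_one, mul_one, Real.norm_eq_abs] at h1
          rw [Real.norm_eq_abs, abs_abs]
          exact h1.trans h2)
      exact (le_abs_self _).trans this
    have hc : Continuous fun ω : DForm d 1 => (lipConst (coordFun k) : ℝ) *
        (‖TestFunction.toBoundedContinuousFunctionCLM ℝ ω‖ * μ.real Set.univ) :=
      continuous_const.mul
        (((TestFunction.toBoundedContinuousFunctionCLM ℝ).continuous.norm).mul continuous_const)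
    rw [ContinuousAt, map_zero]
    refine squeeze_zero_norm hb ?_
    have h0 := hc.tendsto 0
    rwa [map_zero, norm_zero, zero_mul, mul_zero] at h0

theorem MetricOneCurrent.toDeRham_apply {d : ℕ}
    (T : MetricOneCurrent (EuclideanSpace ℝ (Fin d))) (ω : DForm d 1) :
    T.toDeRham ω = ∑ k : Fin d, T.toBilin (ω.coeff k) (coordFun k) := rfl

/-!
# Metric `1`-currents of finite mass in `ℝ^d` are flat chains

The normal currents approximating `T` are its mollifications `T.mollify ν`, given by
`ω ↦ T(ω_ν)` with `ω_ν x = ∫ ω (x + y) dν(y)`, where `ν` is a smooth probability measure on a small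
ball of radius `ε`. Their mass is controlled by that of `T`, and so is the mass of their boundary,
because an integration by parts moves the derivative from the test function to the density of `ν`
(`exists_smoothing_measure`, `MetricOneCurrent.isNormal_mollify`).

For the convergence in the flat norm, let `ω` be a form with `‖ω‖ ≤ 1` and `‖dω‖ ≤ 1`. The homotopy
between the identity and the translations yields `ω_ν - ω = dπ + e`, where
`π x = ∫ ∫₀¹ ω (x + t y) (y) dt dν(y)` is at most `ε` and `e`, an average of integrals of `dω`, is
also at most `ε` (`exists_potential`). As both `ω_ν - ω` and `e` are bounded, so is `dπ`: the
potential `π` is `3`-Lipschitz. The chain rule `T(dπ) = T(1, π)`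
(`MetricOneCurrent.toBilin_one_eq_pairing`), a consequence of locality and finite mass, shows that
`T(ω_ν) - T(ω)` equals `T(1, π)` up to `O(ε)`. By the continuity axiom `T(1, π)` tends to `0` when
`π` tends to `0` uniformly with bounded Lipschitz constants, hence uniformly in `ω`
(`MetricOneCurrent.exists_forall_abs_le`). It is here that metric currents differ from arbitrary
vector measures.
-/

/-! ### Elementary properties of metric `1`-currents -/

theorem lipConst_le {E : Type*} [MetricSpace E] {π : LipFun E} {K : ℝ≥0}
    (h : LipschitzWith K (π : E → ℝ)) : lipConst π ≤ K :=
  csInf_le' h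

namespace BoundedBorel

variable {E : Type*} [MeasurableSpace E]

/-- The constant function `1`. -/
def one (E : Type*) [MeasurableSpace E] : BoundedBorel E :=
  ⟨fun _ => 1, measurable_const, 1, fun _ => by simp⟩

/-- Multiplication by the indicator function of a measurable set. -/
noncomputable def restrict {A : Set E} (hA : MeasurableSet A) :
    BoundedBorel E →ₗ[ℝ] BoundedBorel E where
  toFun f := ⟨A.indicator f, f.2.1.indicator hA, by
    obtain ⟨C, hC⟩ := f.2.2
    refine ⟨C, fun x => ?_⟩
    by_cases hx : x ∈ A
    · simpa [hx] using hC x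
    · simpa [hx] using (abs_nonneg _).trans (hC x)⟩
  map_add' f g := Subtype.ext (Set.indicator_add A (f : E → ℝ) g)
  map_smul' c f := Subtype.ext (Set.indicator_const_smul A c (f : E → ℝ))

theorem restrict_apply {A : Set E} (hA : MeasurableSet A) (f : BoundedBorel E) (x : E) :
    (restrict hA f : E → ℝ) x = A.indicator f x := rfl

theorem integral_abs_restrict_le {A : Set E} (hA : MeasurableSet A) (f : BoundedBorel E)
    (μ : Measure E) [IsFiniteMeasure μ] {C : ℝ} (hC : ∀ x ∈ A, |(f : E → ℝ) x| ≤ C) :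
    ∫ x, |(restrict hA f : E → ℝ) x| ∂μ ≤ C * μ.real A := by
  have h1 : ∀ x, |(restrict hA f : E → ℝ) x| = A.indicator (fun x => |(f : E → ℝ) x|) x := by
    intro x
    rw [restrict_apply]
    by_cases hx : x ∈ A <;> simp [hx]
  simp_rw [h1]
  rw [integral_indicator hA]
  have := norm_setIntegral_le_of_norm_le_const (μ := μ) (s := A)
    (f := fun x => |(f : E → ℝ) x|) (C := C) (measure_lt_top μ A)
    (fun x hx => by simpa using hC x hx)
  exact (le_abs_self _).trans this

/-- A bounded Borel function is integrable for every finite measure, and so are its translates. -/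
theorem integrable_translate [AddCommGroup E] [MeasurableAdd E] (f : BoundedBorel E)
    (ν : Measure E) [IsFiniteMeasure ν] (x : E) :
    Integrable (fun y => (f : E → ℝ) (x + y)) ν := by
  obtain ⟨hf, C, hC⟩ := f.2
  exact Integrable.of_bound (hf.comp (measurable_const_add x)).aestronglyMeasurable C
    (Eventually.of_forall fun y => hC (x + y))

/-- The average `x ↦ ∫ f (x + y) dν(y)` of the translates of `f` with respect to a finite
measure `ν`. -/
noncomputable def average [AddCommGroup E] [MeasurableAdd₂ E] (ν : Measure E)
    [IsFiniteMeasure ν] : BoundedBorel E →ₗ[ℝ] BoundedBorel E where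
  toFun f := ⟨fun x => ∫ y, (f : E → ℝ) (x + y) ∂ν, by
    obtain ⟨hf, C, hC⟩ := f.2
    refine ⟨?_, C * ν.real Set.univ, fun x => ?_⟩
    · have h : StronglyMeasurable (Function.uncurry fun x y : E => (f : E → ℝ) (x + y)) :=
        (hf.comp measurable_add).stronglyMeasurable
      exact h.integral_prod_right.measurable
    · exact norm_integral_le_of_norm_le_const (f := fun y => (f : E → ℝ) (x + y))
        (Eventually.of_forall fun y => hC (x + y))⟩
  map_add' f g := Subtype.ext <| funext fun x =>
    integral_add (integrable_translate f ν x) (integrable_translate g ν x)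
  map_smul' c f := Subtype.ext <| funext fun x =>
    integral_const_mul c fun y => (f : E → ℝ) (x + y)

theorem average_apply [AddCommGroup E] [MeasurableAdd₂ E] (ν : Measure E)
    [IsFiniteMeasure ν] (f : BoundedBorel E) (x : E) :
    (average ν f : E → ℝ) x = ∫ y, (f : E → ℝ) (x + y) ∂ν := rfl

theorem abs_average_le [AddCommGroup E] [MeasurableAdd₂ E] (ν : Measure E)
    [IsProbabilityMeasure ν] {f : BoundedBorel E} {C : ℝ} (hC : ∀ x, |(f : E → ℝ) x| ≤ C) (x : E) :
    |(average ν f : E → ℝ) x| ≤ C := by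
  have := norm_integral_le_of_norm_le_const (μ := ν)
    (f := fun y => (f : E → ℝ) (x + y)) (Eventually.of_forall fun y => hC (x + y))
  rwa [probReal_univ, mul_one] at this

end BoundedBorel

namespace MetricOneCurrent

section Metric

variable {E : Type*} [MetricSpace E] [MeasurableSpace E] [BorelSpace E]

/-- `μ` dominates the mass of `T`: it is admissible in the finite mass axiom. -/
def IsMassBound (T : MetricOneCurrent E) (μ : Measure E) : Prop :=
  ∀ (f : BoundedBorel E) (π : LipFun E),
    |T.toBilin f π| ≤ lipConst π * ∫ x, |(f : E → ℝ) x| ∂μ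

theorem IsMassBound.abs_le {T : MetricOneCurrent E} {μ : Measure E} (hT : T.IsMassBound μ)
    {f : BoundedBorel E} {π : LipFun E} {K : ℝ≥0} (hK : LipschitzWith K (π : E → ℝ)) {I : ℝ}
    (hI : ∫ x, |(f : E → ℝ) x| ∂μ ≤ I) : |T.toBilin f π| ≤ K * I := by
  refine (hT f π).trans (mul_le_mul (NNReal.coe_le_coe.2 (lipConst_le hK)) hI ?_ K.2)
  exact integral_nonneg fun x => abs_nonneg _

/-- The continuity axiom, made uniform: `T(f, π)` is small as soon as `π` is uniformly small,
among functions with a given bound on the Lipschitz constant. -/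
theorem exists_forall_abs_le (T : MetricOneCurrent E) (f : BoundedBorel E) (K : ℝ≥0) {η : ℝ}
    (hη : 0 < η) : ∃ δ > 0, ∀ π : LipFun E, LipschitzWith K (π : E → ℝ) →
      (∀ x, |(π : E → ℝ) x| ≤ δ) → |T.toBilin f π| ≤ η := by
  by_contra! h
  choose π hK hπ hT using fun n : ℕ => h (1 / ((n : ℝ) + 1)) Nat.one_div_pos_of_nat
  have h0 := T.continuity f π 0 ⟨K, fun n => lipConst_le (hK n)⟩ fun x =>
    squeeze_zero_norm (fun n => hπ n x) tendsto_one_div_add_atTop_nhds_zero_nat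
  rw [map_zero] at h0
  obtain ⟨n, hn⟩ := (h0.abs.eventually (gt_mem_nhds (by simpa using hη))).exists
  exact (hT n).not_gt hn

end Metric

/-! ### The chain rule -/

variable {d : ℕ}

/-- The action `a ↦ ∑ k, T(a k, x_k)` of a metric current in `ℝ^d` on bounded Borel
`1`-forms `∑ k, a k dx_k`. -/
noncomputable def pairing (T : MetricOneCurrent (EuclideanSpace ℝ (Fin d))) :
    (Fin d → BoundedBorel (EuclideanSpace ℝ (Fin d))) →ₗ[ℝ] ℝ :=
  ∑ k, (T.toBilin.flip (coordFun k)).comp (LinearMap.proj k)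

theorem pairing_apply (T : MetricOneCurrent (EuclideanSpace ℝ (Fin d)))
    (a : Fin d → BoundedBorel (EuclideanSpace ℝ (Fin d))) :
    T.pairing a = ∑ k, T.toBilin (a k) (coordFun k) := by
  simp [pairing]

theorem lipschitzWith_coordFun (k : Fin d) :
    LipschitzWith 1 (coordFun k : EuclideanSpace ℝ (Fin d) → ℝ) :=
  LipschitzWith.of_dist_le_mul fun x y => by
    simpa [dist_eq_norm, coordFun] using PiLp.norm_apply_le (x - y) k

theorem IsMassBound.abs_pairing_le_of_integral_le
    {T : MetricOneCurrent (EuclideanSpace ℝ (Fin d))} {μ : Measure (EuclideanSpace ℝ (Fin d))}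
    (hT : T.IsMassBound μ) {a : Fin d → BoundedBorel (EuclideanSpace ℝ (Fin d))} {I : ℝ}
    (hI : ∀ k, ∫ x, |(a k : EuclideanSpace ℝ (Fin d) → ℝ) x| ∂μ ≤ I) :
    |T.pairing a| ≤ d * I := by
  rw [pairing_apply]
  refine (Finset.abs_sum_le_sum_abs _ _).trans ?_
  refine (Finset.sum_le_sum fun k _ => hT.abs_le (lipschitzWith_coordFun k) (hI k)).trans ?_
  simp

theorem IsMassBound.abs_pairing_le
    {T : MetricOneCurrent (EuclideanSpace ℝ (Fin d))} {μ : Measure (EuclideanSpace ℝ (Fin d))}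
    [IsFiniteMeasure μ]
    (hT : T.IsMassBound μ) {a : Fin d → BoundedBorel (EuclideanSpace ℝ (Fin d))} {C : ℝ}
    (hC : ∀ k x, |(a k : EuclideanSpace ℝ (Fin d) → ℝ) x| ≤ C) :
    |T.pairing a| ≤ d * (C * μ.real Set.univ) := by
  refine hT.abs_pairing_le_of_integral_le fun k => ?_
  have := norm_integral_le_of_norm_le_const (μ := μ)
    (f := fun x => |(a k : EuclideanSpace ℝ (Fin d) → ℝ) x|)
    (Eventually.of_forall fun x => by simpa using hC k x)
  exact (le_abs_self _).trans this

open BoundedBorel in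
/-- On a ball where the derivative of `π` oscillates by at most `δ`, the function `π` differs from
an affine function by a `δ`-Lipschitz one, so that the chain rule holds there up to `δ`. -/
theorem IsMassBound.abs_chain_rule_ball_le
    {T : MetricOneCurrent (EuclideanSpace ℝ (Fin d))} {μ : Measure (EuclideanSpace ℝ (Fin d))}
    [IsFiniteMeasure μ] (hT : T.IsMassBound μ)
    {π : LipFun (EuclideanSpace ℝ (Fin d))}
    {G : EuclideanSpace ℝ (Fin d) → EuclideanSpace ℝ (Fin d) →L[ℝ] ℝ}
    (hG : ∀ x, HasFDerivAt (π : EuclideanSpace ℝ (Fin d) → ℝ) (G x) x)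
    {a : Fin d → BoundedBorel (EuclideanSpace ℝ (Fin d))}
    (ha : ∀ k x, (a k : EuclideanSpace ℝ (Fin d) → ℝ) x = G x (EuclideanSpace.single k 1))
    {x₀ : EuclideanSpace ℝ (Fin d)} {r : ℝ} {δ : ℝ≥0}
    (hδ : ∀ x ∈ Metric.ball x₀ r, ‖G x - G x₀‖ ≤ δ)
    {A : Set (EuclideanSpace ℝ (Fin d))} (hA : MeasurableSet A) (hAr : A ⊆ Metric.ball x₀ r) :
    |T.toBilin (restrict hA (one _)) π - T.pairing (fun k => restrict hA (a k))|
      ≤ (1 + d) * δ * μ.real A := by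
  set ℓ : LipFun (EuclideanSpace ℝ (Fin d)) :=
    ∑ k, G x₀ (EuclideanSpace.single k 1) • coordFun k with hℓdef
  have hℓ : ∀ x, (ℓ : EuclideanSpace ℝ (Fin d) → ℝ) x = G x₀ x := by
    intro x
    conv_rhs => rw [← (EuclideanSpace.basisFun (Fin d) ℝ).sum_repr x]
    simp [hℓdef, coordFun, Finset.sum_apply, mul_comm]
  have hlip : LipschitzOnWith δ
      (fun x => (π : EuclideanSpace ℝ (Fin d) → ℝ) x - G x₀ x) (Metric.ball x₀ r) := by
    refine (convex_ball x₀ r).lipschitzOnWith_of_nnnorm_hasFDerivWithin_le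
      (f' := fun x => G x - G x₀)
      (fun x _ => ((hG x).sub (G x₀).hasFDerivAt).hasFDerivWithinAt) fun x hx => ?_
    exact_mod_cast hδ x hx
  -- By locality, the remainder may be replaced by a Lipschitz extension `q` from the ball, with the
  -- same small constant.
  obtain ⟨q, hq, hqeq⟩ := hlip.extend_real
  set Q : LipFun (EuclideanSpace ℝ (Fin d)) := ⟨q, δ, hq⟩ with hQ
  have hloc : T.toBilin (restrict hA (one _)) (π - ℓ - Q) = 0 := by
    refine T.locality _ _ ⟨0, fun x hx => ?_⟩
    have hxA : x ∈ A := by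
      by_contra h
      exact hx (by simp [restrict_apply, h])
    have h1 := hqeq (hAr hxA)
    change (π : EuclideanSpace ℝ (Fin d) → ℝ) x - (ℓ : EuclideanSpace ℝ (Fin d) → ℝ) x - q x = 0
    rw [hℓ, ← h1]
    simp
  have hl : T.toBilin (restrict hA (one _)) ℓ =
      T.pairing fun k => restrict hA (G x₀ (EuclideanSpace.single k 1) • one _) := by
    rw [pairing_apply, hℓdef, map_sum]
    simp
  have key : T.toBilin (restrict hA (one _)) π - T.pairing (fun k => restrict hA (a k)) =
      T.toBilin (restrict hA (one _)) Q +
        T.pairing (fun k => restrict hA (G x₀ (EuclideanSpace.single k 1) • one _ - a k)) := by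
    have h2 : (fun k => restrict hA (G x₀ (EuclideanSpace.single k 1) • one _ - a k)) =
        (fun k => restrict hA (G x₀ (EuclideanSpace.single k 1) • one _)) -
          fun k => restrict hA (a k) := by
      ext1 k
      rw [map_sub]
      rfl
    rw [h2, map_sub, ← hl]
    rw [map_sub, map_sub] at hloc
    linarith
  have b1 : |T.toBilin (restrict hA (one _)) Q| ≤ δ * (1 * μ.real A) :=
    hT.abs_le hq (integral_abs_restrict_le hA _ μ fun x _ => by simp [one])
  have b2 : |T.pairing (fun k => restrict hA (G x₀ (EuclideanSpace.single k 1) • one _ - a k))|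
      ≤ d * (δ * μ.real A) := by
    refine hT.abs_pairing_le_of_integral_le fun k =>
      integral_abs_restrict_le hA _ μ fun x hx => ?_
    have h3 : ((G x₀ (EuclideanSpace.single k 1) • one _ - a k :
        BoundedBorel (EuclideanSpace ℝ (Fin d))) : EuclideanSpace ℝ (Fin d) → ℝ) x =
        -((G x - G x₀) (EuclideanSpace.single k 1)) := by
      change G x₀ (EuclideanSpace.single k 1) * 1 - (a k : EuclideanSpace ℝ (Fin d) → ℝ) x = _
      rw [ha]
      simp
    rw [h3, abs_neg]
    refine ((G x - G x₀).le_opNorm _).trans ?_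
    simpa using hδ x (hAr hx)
  rw [key]
  refine (abs_add_le _ _).trans ?_
  linarith

open BoundedBorel in
/-- The chain rule `T(1, π) = ∑ k, T(∂_k π, x_k)` for `π` of class `C¹` with compact support. -/
theorem toBilin_one_eq_pairing
    (T : MetricOneCurrent (EuclideanSpace ℝ (Fin d))) {π : LipFun (EuclideanSpace ℝ (Fin d))}
    {G : EuclideanSpace ℝ (Fin d) → EuclideanSpace ℝ (Fin d) →L[ℝ] ℝ}
    (hG : ∀ x, HasFDerivAt (π : EuclideanSpace ℝ (Fin d) → ℝ) (G x) x) (hGc : Continuous G)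
    (hπ : HasCompactSupport (π : EuclideanSpace ℝ (Fin d) → ℝ))
    {a : Fin d → BoundedBorel (EuclideanSpace ℝ (Fin d))}
    (ha : ∀ k x, (a k : EuclideanSpace ℝ (Fin d) → ℝ) x = G x (EuclideanSpace.single k 1)) :
    T.toBilin (one _) π = T.pairing a := by
  obtain ⟨μ, hμ, hT⟩ := T.finite_mass
  replace hT : T.IsMassBound μ := hT
  -- The defect in the chain rule, a finitely additive function of the set `A`.
  set D : ∀ A : Set (EuclideanSpace ℝ (Fin d)), MeasurableSet A → ℝ := fun A hA =>
    T.toBilin (restrict hA (one _)) π - T.pairing (fun k => restrict hA (a k)) with hD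
  have hadd : ∀ A B C (hA : MeasurableSet A) (hB : MeasurableSet B) (hC : MeasurableSet C),
      Disjoint A B → A ∪ B = C → D C hC = D A hA + D B hB := by
    rintro A B C hA hB hC hAB rfl
    have h (f : BoundedBorel (EuclideanSpace ℝ (Fin d))) :
        restrict hC f = restrict hA f + restrict hB f :=
      Subtype.ext (Set.indicator_union_of_disjoint hAB _)
    have h' : (fun k => restrict hC (a k)) =
        (fun k => restrict hA (a k)) + fun k => restrict hB (a k) := funext fun k => h (a k)
    simp only [hD]
    rw [h', h, map_add, map_add, LinearMap.add_apply]
    ring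
  have hK : IsCompact (tsupport (π : EuclideanSpace ℝ (Fin d) → ℝ)) := hπ
  have hKm := hK.measurableSet
  have hout : D _ hKm.compl = 0 := by
    have h1 : T.toBilin (restrict hKm.compl (one _)) π = 0 := by
      refine T.locality _ _ ⟨0, fun x hx => image_eq_zero_of_notMem_tsupport fun h => hx ?_⟩
      simp [restrict_apply, h]
    have h2 : (fun k => restrict hKm.compl (a k)) = 0 := by
      funext k
      refine Subtype.ext (funext fun x => ?_)
      rw [restrict_apply]
      by_cases hx : x ∈ tsupport (π : EuclideanSpace ℝ (Fin d) → ℝ)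
      · simp [hx]
      · have h3 : G x = 0 := by
          rw [← (hG x).fderiv]
          exact fderiv_of_notMem_tsupport ℝ hx
        simp [hx, ha, h3]
    simp [hD, h1, h2]
  -- The estimate on small balls is additive in `A`, hence by compactness it passes to the support.
  -- Measurable covers `S` are carried along, to be able to cut `A` into measurable pieces.
  have hin (δ : ℝ≥0) (hδ : 0 < δ) : |D _ hKm| ≤ (1 + d) * δ * μ.real Set.univ := by
    have : ∃ S, MeasurableSet S ∧ tsupport (π : EuclideanSpace ℝ (Fin d) → ℝ) ⊆ S ∧
        ∀ A (hA : MeasurableSet A), A ⊆ S → |D A hA| ≤ (1 + d) * δ * μ.real A := by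
      refine hK.induction_on (p := fun U => ∃ S, MeasurableSet S ∧ U ⊆ S ∧
        ∀ A (hA : MeasurableSet A), A ⊆ S → |D A hA| ≤ (1 + d) * δ * μ.real A) ?_ ?_ ?_ ?_
      · refine ⟨∅, .empty, subset_rfl, fun A hA hA0 => ?_⟩
        obtain rfl := Set.subset_empty_iff.1 hA0
        have := hadd ∅ ∅ ∅ hA hA hA (by simp) (by simp)
        have h0 : D ∅ hA = 0 := by linarith
        simp [h0]
      · rintro U V hUV ⟨S, hS, hVS, h⟩
        exact ⟨S, hS, hUV.trans hVS, h⟩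
      · rintro U V ⟨S, hS, hUS, h⟩ ⟨S', hS', hVS', h'⟩
        refine ⟨S ∪ S', hS.union hS', Set.union_subset_union hUS hVS', fun A hA hAS => ?_⟩
        rw [hadd (A ∩ S) (A \ S) A (hA.inter hS) (hA.diff hS) hA
          (Set.disjoint_sdiff_inter.symm) (Set.inter_union_sdiff A S)]
        have e1 := h (A ∩ S) (hA.inter hS) Set.inter_subset_right
        have e2 := h' (A \ S) (hA.diff hS) fun x hx => (hAS hx.1).resolve_left hx.2
        have e3 : μ.real (A ∩ S) + μ.real (A \ S) = μ.real A :=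
          measureReal_inter_add_sdiff hS
        rw [← e3, mul_add]
        exact (abs_add_le _ _).trans (add_le_add e1 e2)
      · intro x _
        obtain ⟨r, hr, hxr⟩ :=
          Metric.continuousAt_iff.1 hGc.continuousAt (δ : ℝ) (by exact_mod_cast hδ)
        refine ⟨Metric.ball x r, mem_nhdsWithin_of_mem_nhds (Metric.ball_mem_nhds x hr),
          Metric.ball x r, Metric.isOpen_ball.measurableSet, subset_rfl, fun A hA hAr => ?_⟩
        refine hT.abs_chain_rule_ball_le hG ha (fun y hy => ?_) hA hAr
        rw [← dist_eq_norm]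
        exact (hxr hy).le
    obtain ⟨S, -, hKS, h⟩ := this
    refine (h _ hKm hKS).trans ?_
    exact mul_le_mul_of_nonneg_left (measureReal_mono (Set.subset_univ _)) (by positivity)
  have hin0 : D _ hKm = 0 := by
    refine abs_nonpos_iff.1 (le_of_forall_pos_le_add fun η hη => ?_)
    have ht : 0 < η / ((1 + d) * (μ.real Set.univ + 1)) := by positivity
    have h1 := hin _ (Real.toNNReal_pos.2 ht)
    rw [Real.coe_toNNReal _ ht.le] at h1
    refine h1.trans ?_
    have : (1 + (d : ℝ)) * (η / ((1 + d) * (μ.real Set.univ + 1))) * μ.real Set.univ =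
      η * (μ.real Set.univ / (μ.real Set.univ + 1)) := by field_simp
    rw [this, zero_add]
    refine mul_le_of_le_one_right hη.le ((div_le_one (by positivity)).2 (by linarith))
  have huniv := hadd _ _ _ hKm hKm.compl MeasurableSet.univ disjoint_compl_right
    (Set.union_compl_self _)
  rw [hin0, hout, add_zero] at huniv
  have hr (f : BoundedBorel (EuclideanSpace ℝ (Fin d))) : restrict MeasurableSet.univ f = f :=
    Subtype.ext (Set.indicator_univ _)
  simp only [hD, hr] at huniv
  linarith

end MetricOneCurrent

/-! ### The translation homotopy -/

section Homotopy

theorem exists_forall_norm_fderiv_le {E F : Type*} [NormedAddCommGroup E] [NormedSpace ℝ E]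
    [NormedAddCommGroup F] [NormedSpace ℝ F] {f : E → F} (hf : ContDiff ℝ 1 f)
    (hc : HasCompactSupport f) : ∃ M, ∀ x, ‖fderiv ℝ f x‖ ≤ M :=
  (hc.fderiv ℝ).exists_bound_of_continuous (hf.continuous_fderiv one_ne_zero)

variable {E : Type*} [NormedAddCommGroup E] [NormedSpace ℝ E] [FiniteDimensional ℝ E]
  [MeasurableSpace E] [BorelSpace E]

/-- If `θ` is a `C¹` `1`-form with compact support and `ν` is a probability measure on the ball of
radius `ε`, then the average of the translates of `θ` differs from `θ` by an exact form `dπ` with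
`|π| ≤ ε ‖θ‖` and by an error of size `ε ‖dθ‖`. The potential is the average over `y` of the
integrals of `θ` along the segments `[x, x + y]`. -/
theorem exists_potential {θ : E → E →L[ℝ] ℝ} (hθ : ContDiff ℝ 1 θ) (hc : HasCompactSupport θ)
    {a b ε : ℝ} (ha : ∀ x, ‖θ x‖ ≤ a)
    (hb : ∀ x v w, |fderiv ℝ θ x v w - fderiv ℝ θ x w v| ≤ b * (‖v‖ * ‖w‖))
    {ν : Measure E} [IsProbabilityMeasure ν] (hν : ∀ᵐ y ∂ν, ‖y‖ ≤ ε) :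
    ∃ (π : E → ℝ) (G : E → E →L[ℝ] ℝ), (∀ x, HasFDerivAt π (G x) x) ∧ Continuous G ∧
      HasCompactSupport π ∧ (∀ x, |π x| ≤ a * ε) ∧
      ∀ x v, |G x v - (∫ y, θ (x + y) v ∂ν - θ x v)| ≤ b * (‖v‖ * ε) := by
  have ha0 : 0 ≤ a := (norm_nonneg _).trans (ha 0)
  have hε : 0 ≤ ε := by
    obtain ⟨y, hy⟩ := hν.exists
    exact (norm_nonneg y).trans hy
  have hθd : Differentiable ℝ θ := hθ.differentiable one_ne_zero
  have hDc : Continuous (fderiv ℝ θ) := hθ.continuous_fderiv one_ne_zero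
  obtain ⟨M, hM⟩ := exists_forall_norm_fderiv_le hθ hc
  have hM0 : 0 ≤ M := (norm_nonneg _).trans (hM 0)
  -- The integrals over `y` and over the segment are taken at once, with respect to `P`.
  set P : Measure (E × ℝ) := ν.prod (volume.restrict (Set.Ioc (0 : ℝ) 1)) with hPdef
  have : IsProbabilityMeasure (volume.restrict (Set.Ioc (0 : ℝ) 1)) := ⟨by simp⟩
  have hP : ∀ᵐ p ∂P, ‖p.1‖ ≤ ε ∧ p.2 ∈ Set.Ioc (0 : ℝ) 1 := by
    have h1 : ∀ᵐ p ∂P, ‖p.1‖ ≤ ε := Measure.quasiMeasurePreserving_fst.ae hν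
    have h2 : ∀ᵐ p ∂P, p.2 ∈ Set.Ioc (0 : ℝ) 1 :=
      Measure.quasiMeasurePreserving_snd.ae (ae_restrict_mem measurableSet_Ioc)
    exact h1.and h2
  set F : E → E × ℝ → ℝ := fun x p => θ (x + p.2 • p.1) p.1 with hF
  set F' : E → E × ℝ → E →L[ℝ] ℝ := fun x p =>
    (ContinuousLinearMap.apply ℝ ℝ p.1).comp (fderiv ℝ θ (x + p.2 • p.1)) with hF'
  have hFc : Continuous (Function.uncurry F) := by
    simp only [hF, Function.uncurry_def]
    have := hθ.continuous
    fun_prop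
  have hF'c : Continuous (Function.uncurry F') := by
    simp only [hF', Function.uncurry_def]
    fun_prop
  have hFb : ∀ x, ∀ᵐ p ∂P, ‖F x p‖ ≤ a * ε := fun x => by
    filter_upwards [hP] with p hp
    refine ((θ _).le_opNorm _).trans ?_
    exact mul_le_mul (ha _) hp.1 (norm_nonneg _) ha0
  have hF'v : ∀ x p v, F' x p v = fderiv ℝ θ (x + p.2 • p.1) v p.1 := fun x p v => rfl
  have hF'p : ∀ x p, ‖p.1‖ ≤ ε → ‖F' x p‖ ≤ M * ε := fun x p hp => by
    refine ContinuousLinearMap.opNorm_le_bound _ (by positivity) fun v => ?_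
    rw [hF'v]
    refine ((fderiv ℝ θ _ v).le_opNorm _).trans ?_
    have h1 : ‖fderiv ℝ θ (x + p.2 • p.1) v‖ ≤ M * ‖v‖ :=
      ((fderiv ℝ θ _).le_opNorm _).trans (by gcongr; exact hM _)
    calc _ ≤ M * ‖v‖ * ε := mul_le_mul h1 hp (norm_nonneg _) (by positivity)
      _ = _ := by ring
  have hF'b : ∀ x, ∀ᵐ p ∂P, ‖F' x p‖ ≤ M * ε := fun x => by
    filter_upwards [hP] with p hp using hF'p x p hp.1
  have hFi : ∀ x, Integrable (F x) P := fun x =>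
    Integrable.of_bound (hFc.comp (by fun_prop : Continuous fun p => (x, p))).aestronglyMeasurable
      _ (hFb x)
  have hF'm : ∀ x, AEStronglyMeasurable (F' x) P := fun x =>
    (hF'c.comp (by fun_prop : Continuous fun p => (x, p))).aestronglyMeasurable
  have hF'i : ∀ x, Integrable (F' x) P := fun x => Integrable.of_bound (hF'm x) _ (hF'b x)
  refine ⟨fun x => ∫ p, F x p ∂P, fun x => ∫ p, F' x p ∂P, fun x => ?_, ?_, ?_, fun x => ?_,
    fun x v => ?_⟩
  · refine hasFDerivAt_integral_of_dominated_of_fderiv_le (F := F) (F' := F')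
      (bound := fun _ => M * ε) univ_mem
      (Eventually.of_forall fun x => (hFi x).aestronglyMeasurable) (hFi x) (hF'm x)
      ?_ (integrable_const _) ?_
    · filter_upwards [hP] with p hp x _ using hF'p x p hp.1
    · refine Eventually.of_forall fun p x _ => ?_
      have h1 : HasFDerivAt (fun x => θ (x + p.2 • p.1)) (fderiv ℝ θ (x + p.2 • p.1)) x :=
        (hasFDerivAt_comp_add_right _).2 (hθd _).hasFDerivAt
      exact (ContinuousLinearMap.apply ℝ ℝ p.1).hasFDerivAt.comp x h1
  · exact continuous_of_dominated hF'm (bound := fun _ => M * ε) hF'b (integrable_const _)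
      (Eventually.of_forall fun p => hF'c.comp (by fun_prop : Continuous fun x => (x, p)))
  · obtain ⟨R, hR⟩ := hc.isCompact.isBounded.subset_closedBall (0 : E)
    refine HasCompactSupport.intro (isCompact_closedBall (0 : E) (R + ε)) fun x hx => ?_
    refine integral_eq_zero_of_ae ?_
    filter_upwards [hP] with p hp
    have h1 : x + p.2 • p.1 ∉ tsupport θ := fun h => hx <| by
      have h2 := hR h
      rw [mem_closedBall_zero_iff] at h2 ⊢
      have h3 : ‖p.2 • p.1‖ ≤ ε := by
        rw [norm_smul, Real.norm_of_nonneg hp.2.1.le]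
        exact (mul_le_of_le_one_left (norm_nonneg _) hp.2.2).trans hp.1
      calc ‖x‖ = ‖x + p.2 • p.1 - p.2 • p.1‖ := by rw [add_sub_cancel_right]
        _ ≤ _ := (norm_sub_le _ _).trans (add_le_add h2 h3)
    simp [hF, image_eq_zero_of_notMem_tsupport h1]
  · have := norm_integral_le_of_norm_le_const (hFb x)
    rwa [probReal_univ, mul_one] at this
  · -- The derivative of `θ` along the segment integrates to the increment of `θ`.
    set H : E × ℝ → ℝ := fun p => fderiv ℝ θ (x + p.2 • p.1) p.1 v with hH
    have hHc : Continuous H := by simp only [hH]; fun_prop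
    have hHi : Integrable H P := by
      refine Integrable.of_bound hHc.aestronglyMeasurable (M * ε * ‖v‖) ?_
      filter_upwards [hP] with p hp
      refine ((fderiv ℝ θ _ p.1).le_opNorm _).trans ?_
      gcongr
      exact ((fderiv ℝ θ _).le_opNorm _).trans (mul_le_mul (hM _) hp.1 (norm_nonneg _) hM0)
    have hftc : ∀ y, ∫ t in Set.Ioc (0 : ℝ) 1, H (y, t) = θ (x + y) v - θ x v := fun y => by
      have h1 : ∀ t ∈ Set.uIcc (0 : ℝ) 1,
          HasDerivAt (fun t : ℝ => θ (x + t • y) v) (H (y, t)) t := fun t _ => by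
        have h2 : HasDerivAt (fun t : ℝ => x + t • y) y t := by
          simpa using ((hasDerivAt_id t).smul_const y).const_add x
        have h3 := (hθd (x + t • y)).hasFDerivAt.comp_hasDerivAt t h2
        exact (ContinuousLinearMap.apply ℝ ℝ v).hasFDerivAt.comp_hasDerivAt t h3
      have h4 := intervalIntegral.integral_eq_sub_of_hasDerivAt h1
        ((hHc.comp (by fun_prop : Continuous fun t : ℝ => (y, t))).intervalIntegrable 0 1)
      rw [intervalIntegral.integral_of_le zero_le_one] at h4
      simpa using h4
    have hθi : Integrable (fun y => θ (x + y) v) ν := by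
      refine Integrable.of_bound (C := a * ‖v‖) ?_ (Eventually.of_forall fun y => ?_)
      · have := hθ.continuous
        exact (by fun_prop : Continuous fun y => θ (x + y) v).aestronglyMeasurable
      · exact ((θ _).le_opNorm _).trans (by gcongr; exact ha _)
    have h5 : ∫ p, H p ∂P = ∫ y, θ (x + y) v ∂ν - θ x v := by
      rw [hPdef, integral_prod _ hHi]
      simp_rw [hftc]
      rw [integral_sub hθi (integrable_const _)]
      simp
    have h6 : (∫ p, F' x p ∂P) v = ∫ p, F' x p v ∂P :=
      ContinuousLinearMap.integral_apply (hF'i x) v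
    rw [h6, ← h5, ← integral_sub ((hF'i x).apply_continuousLinearMap v) hHi]
    have := norm_integral_le_of_norm_le_const (μ := P) (f := fun p => F' x p v - H p)
      (C := b * (‖v‖ * ε)) (by
        filter_upwards [hP] with p hp
        -- The sign of `b` is not given, but the curl bound forces `0 ≤ b` if there is a `v ≠ 0`.
        rcases eq_or_ne v 0 with rfl | hv
        · simp [hF'v, hH]
        have hbv : 0 ≤ b * ‖v‖ := by
          have h7 := (abs_nonneg _).trans (hb 0 v v)
          have h8 : 0 < ‖v‖ := norm_pos_iff.2 hv
          rw [← mul_assoc] at h7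
          exact nonneg_of_mul_nonneg_left h7 h8
        refine (hb _ v p.1).trans ?_
        rw [← mul_assoc, ← mul_assoc]
        gcongr
        exact hp.1)
    rwa [probReal_univ, mul_one] at this

end Homotopy

/-! ### Smooth probability measures -/

/-- There are probability measures `ν` concentrated near the origin, with a smooth density, for
which averaging a derivative costs only the supremum of the function, by integration by parts. -/
theorem exists_smoothing_measure (E : Type*) [NormedAddCommGroup E] [InnerProductSpace ℝ E]
    [FiniteDimensional ℝ E] [MeasurableSpace E] [BorelSpace E] {δ : ℝ} (hδ : 0 < δ) :
    ∃ ν : Measure E, IsProbabilityMeasure ν ∧ (∀ᵐ y ∂ν, ‖y‖ ≤ δ) ∧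
      ∃ C, ∀ g : E → ℝ, ContDiff ℝ 1 g → HasCompactSupport g → (∀ x, |g x| ≤ 1) →
        ∀ x v, |∫ y, fderiv ℝ g (x + y) v ∂ν| ≤ C * ‖v‖ := by
  let φ : ContDiffBump (0 : E) := ⟨δ / 2, δ, half_pos hδ, half_lt_self hδ⟩
  set ρ : E → ℝ := φ.normed volume with hρ
  have hρ0 : ∀ y, 0 ≤ ρ y := fun y => φ.nonneg_normed y
  have hρs : ContDiff ℝ 1 ρ := φ.contDiff_normed (n := 1)
  have hρc : HasCompactSupport ρ := φ.hasCompactSupport_normed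
  have hρm : Measurable fun y => (ρ y).toNNReal := hρs.continuous.measurable.real_toNNReal
  have hD : Continuous (fderiv ℝ ρ) := hρs.continuous_fderiv one_ne_zero
  have hDi : Integrable (fun y => ‖fderiv ℝ ρ y‖) volume :=
    hD.norm.integrable_of_hasCompactSupport (hρc.fderiv ℝ).norm
  refine ⟨volume.withDensity fun y => ((ρ y).toNNReal : ℝ≥0∞), ⟨?_⟩, ?_,
    ∫ y, ‖fderiv ℝ ρ y‖, fun g hg hgc hg1 x v => ?_⟩
  · rw [withDensity_apply _ MeasurableSet.univ, Measure.restrict_univ]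
    change ∫⁻ y, ENNReal.ofReal (ρ y) = 1
    rw [← ofReal_integral_eq_lintegral_ofReal φ.integrable_normed (Eventually.of_forall hρ0),
      φ.integral_normed, ENNReal.ofReal_one]
  · rw [ae_withDensity_iff hρm.coe_nnreal_ennreal]
    refine Eventually.of_forall fun y hy => ?_
    have h1 : y ∈ Function.support ρ := fun h => hy (by simp [h])
    rw [hρ, φ.support_normed_eq] at h1
    exact (mem_ball_zero_iff.1 h1).le
  · rw [integral_withDensity_eq_integral_smul hρm]
    have h1 : ∀ y, (ρ y).toNNReal • fderiv ℝ g (x + y) v =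
        ρ y * fderiv ℝ (fun z => g (x + z)) y v := fun y => by
      rw [fderiv_comp_add_left, NNReal.smul_def, Real.coe_toNNReal _ (hρ0 y), smul_eq_mul]
    simp_rw [h1]
    have hgx : ContDiff ℝ 1 fun z => g (x + z) := by fun_prop
    have hDg : Continuous fun y => fderiv ℝ (fun z => g (x + z)) y v :=
      (hgx.continuous_fderiv one_ne_zero).clm_apply continuous_const
    have hDρ : Continuous fun y => fderiv ℝ ρ y v := hD.clm_apply continuous_const
    have hDρc : HasCompactSupport fun y => fderiv ℝ ρ y v := hρc.fderiv_apply ℝ v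
    have hi : Integrable (fun y => fderiv ℝ ρ y v * g (x + y)) volume :=
      (hDρ.mul hgx.continuous).integrable_of_hasCompactSupport hDρc.mul_right
    rw [integral_mul_fderiv_eq_neg_fderiv_mul_of_integrable hi
      ((hρs.continuous.mul hDg).integrable_of_hasCompactSupport hρc.mul_right)
      ((hρs.continuous.mul hgx.continuous).integrable_of_hasCompactSupport hρc.mul_right)
      (fun y _ => hρs.differentiable one_ne_zero y) (fun y _ => hgx.differentiable one_ne_zero y),
      abs_neg, ← integral_mul_const]
    rw [← Real.norm_eq_abs]
    refine norm_integral_le_of_norm_le (hDi.mul_const _) (Eventually.of_forall fun y => ?_)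
    rw [norm_mul]
    refine (mul_le_of_le_one_right (norm_nonneg _) (hg1 _)).trans ?_
    exact (fderiv ℝ ρ y).le_opNorm v

/-! ### Differential forms of degree zero and one -/

namespace DForm

variable {d : ℕ}

theorem abs_coeff_le {ω : DForm d 1} {C : ℝ} (hω : ∀ x, ‖ω x‖ ≤ C) (k : Fin d)
    (x : EuclideanSpace ℝ (Fin d)) : |(ω.coeff k : EuclideanSpace ℝ (Fin d) → ℝ) x| ≤ C := by
  have h1 := (ω x).le_opNorm (fun _ => EuclideanSpace.single k (1 : ℝ))
  simp only [Finset.univ_unique, Finset.prod_const, Finset.card_singleton, pow_one,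
    PiLp.norm_single, norm_one, mul_one] at h1
  exact h1.trans (hω x)

/-- A `1`-form, as a function with values in the dual space. -/
noncomputable def toDual (ω : DForm d 1) (x : EuclideanSpace ℝ (Fin d)) :
    EuclideanSpace ℝ (Fin d) →L[ℝ] ℝ :=
  (ContinuousAlternatingMap.ofSubsingletonLIE (0 : Fin 1)).symm (ω x)

theorem toDual_apply (ω : DForm d 1) (x v : EuclideanSpace ℝ (Fin d)) :
    ω.toDual x v = ω x fun _ => v := rfl

theorem norm_toDual (ω : DForm d 1) (x : EuclideanSpace ℝ (Fin d)) : ‖ω.toDual x‖ = ‖ω x‖ :=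
  LinearIsometryEquiv.norm_map _ _

theorem contDiff_toDual (ω : DForm d 1) : ContDiff ℝ 1 ω.toDual :=
  (ContinuousAlternatingMap.ofSubsingletonLIE (𝕜 := ℝ) (E := EuclideanSpace ℝ (Fin d))
    (F := ℝ) (0 : Fin 1)).symm.contDiff.comp (ω.contDiff.of_le (by simp))

theorem hasCompactSupport_toDual (ω : DForm d 1) : HasCompactSupport ω.toDual :=
  ω.hasCompactSupport.comp_left (map_zero _)

theorem dCLM_one_apply (ω : DForm d 1) (x v w : EuclideanSpace ℝ (Fin d)) :
    DForm.dCLM d 1 ω x ![v, w] = fderiv ℝ ω.toDual x v w - fderiv ℝ ω.toDual x w v := by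
  have hd : DifferentiableAt ℝ (fun y => ω y) x := ω.contDiff.differentiable (by simp) x
  have hd' : DifferentiableAt ℝ ω.toDual x := ω.contDiff_toDual.differentiable one_ne_zero x
  have h : ∀ (u : EuclideanSpace ℝ (Fin d)) (m : Fin 1 → EuclideanSpace ℝ (Fin d)),
      fderiv ℝ (fun y => ω y m) x u = fderiv ℝ ω.toDual x u (m 0) := fun u m => by
    have h1 : (fun y => ω y m) = fun y => ω.toDual y (m 0) := funext fun y => by
      rw [toDual_apply]
      exact congrArg (ω y) (funext fun i => by rw [Subsingleton.elim i 0])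
    rw [h1, fderiv_clm_apply hd' (differentiableAt_const _)]
    simp
  rw [DForm.dCLM_apply, extDeriv_apply hd, Fin.sum_univ_two]
  simp only [h]
  simp [Fin.removeNth, sub_eq_add_neg]

theorem abs_fderiv_toDual_sub_le {ω : DForm d 1} {b : ℝ} {x : EuclideanSpace ℝ (Fin d)}
    (h : ‖DForm.dCLM d 1 ω x‖ ≤ b) (v w : EuclideanSpace ℝ (Fin d)) :
    |fderiv ℝ ω.toDual x v w - fderiv ℝ ω.toDual x w v| ≤ b * (‖v‖ * ‖w‖) := by
  rw [← dCLM_one_apply]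
  refine ((DForm.dCLM d 1 ω x).le_opNorm _).trans ?_
  rw [Fin.prod_univ_two]
  exact mul_le_mul_of_nonneg_right h (by positivity)

/-- The underlying function of a `0`-form. -/
noncomputable def toFunction (g : DForm d 0) (x : EuclideanSpace ℝ (Fin d)) : ℝ := g x ![]

theorem contDiff_toFunction (g : DForm d 0) : ContDiff ℝ 1 g.toFunction :=
  (ContinuousAlternatingMap.apply ℝ (EuclideanSpace ℝ (Fin d)) ℝ
    (![] : Fin 0 → EuclideanSpace ℝ (Fin d))).contDiff.comp (g.contDiff.of_le (by simp))

theorem hasCompactSupport_toFunction (g : DForm d 0) : HasCompactSupport g.toFunction :=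
  g.hasCompactSupport.comp_left (g := fun A : EuclideanSpace ℝ (Fin d) [⋀^Fin 0]→L[ℝ] ℝ => A ![])
    rfl

theorem abs_toFunction_le (g : DForm d 0) (x : EuclideanSpace ℝ (Fin d)) :
    |g.toFunction x| ≤ ‖g x‖ := by
  simpa [toFunction] using (g x).le_opNorm ![]

theorem coeff_dCLM_zero (g : DForm d 0) (k : Fin d) (x : EuclideanSpace ℝ (Fin d)) :
    ((DForm.dCLM d 0 g).coeff k : EuclideanSpace ℝ (Fin d) → ℝ) x =
      fderiv ℝ g.toFunction x (EuclideanSpace.single k 1) := by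
  have hd : DifferentiableAt ℝ (fun y => g y) x := g.contDiff.differentiable (by simp) x
  change DForm.dCLM d 0 g x (fun _ => EuclideanSpace.single k 1) = _
  rw [DForm.dCLM_apply, extDeriv_apply hd, Fin.sum_univ_one]
  have h : (fun y => g y ((0 : Fin 1).removeNth fun _ => EuclideanSpace.single k 1)) =
      g.toFunction := funext fun y => congrArg (g y) (Subsingleton.elim _ _)
  rw [h]
  simp

end DForm

/-! ### Mollified currents -/

namespace MetricOneCurrent

variable {d : ℕ}

open BoundedBorel in
/-- The de Rham current `ω ↦ T(ω_ν)`, where `ω_ν x = ∫ ω (x + y) dν(y)`: the average with respect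
to `ν` of the translates of the de Rham current associated with `T`. -/
noncomputable def mollify (T : MetricOneCurrent (EuclideanSpace ℝ (Fin d)))
    (ν : Measure (EuclideanSpace ℝ (Fin d))) [IsProbabilityMeasure ν] : DRCurrent d 1 where
  toFun ω := T.pairing fun k => average ν (ω.coeff k)
  map_add' ω η := by
    rw [← map_add]
    exact congrArg T.pairing (funext fun k => map_add (average ν) (ω.coeff k) (η.coeff k))
  map_smul' c ω := by
    rw [RingHom.id_apply, ← map_smul]
    exact congrArg T.pairing (funext fun k => map_smul (average ν) c (ω.coeff k))
  cont := by
    obtain ⟨μ, hμ, hT⟩ := T.finite_mass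
    replace hT : T.IsMassBound μ := hT
    let Φ : DForm d 1 →+ ℝ :=
      { toFun := fun ω => T.pairing fun k => average ν (ω.coeff k)
        map_zero' := by
          rw [← map_zero T.pairing]
          exact congrArg T.pairing (funext fun k => map_zero (average ν))
        map_add' := fun ω η => by
          rw [← map_add]
          exact congrArg T.pairing
            (funext fun k => map_add (average ν) (ω.coeff k) (η.coeff k)) }
    change Continuous Φ
    refine continuous_of_continuousAt_zero Φ ?_
    have hb : ∀ ω : DForm d 1, ‖Φ ω‖ ≤
        d * (‖TestFunction.toBoundedContinuousFunctionCLM ℝ ω‖ * μ.real Set.univ) := fun ω =>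
      hT.abs_pairing_le fun k => abs_average_le ν <| DForm.abs_coeff_le
        (TestFunction.toBoundedContinuousFunctionCLM ℝ ω).norm_coe_le_norm k
    have hc : Continuous fun ω : DForm d 1 => (d : ℝ) *
        (‖TestFunction.toBoundedContinuousFunctionCLM ℝ ω‖ * μ.real Set.univ) :=
      continuous_const.mul
        (((TestFunction.toBoundedContinuousFunctionCLM ℝ).continuous.norm).mul continuous_const)
    rw [ContinuousAt, map_zero]
    refine squeeze_zero_norm hb ?_
    have h0 := hc.tendsto 0
    rwa [map_zero, norm_zero, zero_mul, mul_zero] at h0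

open BoundedBorel

theorem mollify_apply (T : MetricOneCurrent (EuclideanSpace ℝ (Fin d)))
    (ν : Measure (EuclideanSpace ℝ (Fin d))) [IsProbabilityMeasure ν] (ω : DForm d 1) :
    T.mollify ν ω = T.pairing fun k => average ν (ω.coeff k) := rfl

theorem toDeRham_eq_pairing (T : MetricOneCurrent (EuclideanSpace ℝ (Fin d))) (ω : DForm d 1) :
    T.toDeRham ω = T.pairing ω.coeff := by
  rw [toDeRham_apply, pairing_apply]

theorem mass_toDeRham_lt_top (T : MetricOneCurrent (EuclideanSpace ℝ (Fin d))) :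
    DRCurrent.mass T.toDeRham < ∞ := by
  obtain ⟨μ, hμ, hT⟩ := T.finite_mass
  replace hT : T.IsMassBound μ := hT
  refine lt_of_le_of_lt (iSup₂_le fun ω hω => ENNReal.ofReal_le_ofReal ?_)
    (ENNReal.ofReal_lt_top (r := d * (1 * μ.real Set.univ)))
  rw [toDeRham_eq_pairing]
  exact (le_abs_self _).trans (hT.abs_pairing_le (DForm.abs_coeff_le hω))

theorem isNormal_mollify (T : MetricOneCurrent (EuclideanSpace ℝ (Fin d)))
    {ν : Measure (EuclideanSpace ℝ (Fin d))} [IsProbabilityMeasure ν] {C : ℝ}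
    (hC : ∀ g : EuclideanSpace ℝ (Fin d) → ℝ, ContDiff ℝ 1 g → HasCompactSupport g →
      (∀ x, |g x| ≤ 1) → ∀ x v, |∫ y, fderiv ℝ g (x + y) v ∂ν| ≤ C * ‖v‖) :
    (T.mollify ν).IsNormal := by
  obtain ⟨μ, hμ, hT⟩ := T.finite_mass
  replace hT : T.IsMassBound μ := hT
  refine ENNReal.add_lt_top.2 ⟨?_, ?_⟩
  · refine lt_of_le_of_lt (iSup₂_le fun ω hω => ENNReal.ofReal_le_ofReal ?_)
      (ENNReal.ofReal_lt_top (r := d * (1 * μ.real Set.univ)))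
    rw [mollify_apply]
    exact (le_abs_self _).trans
      (hT.abs_pairing_le fun k => abs_average_le ν (DForm.abs_coeff_le hω k))
  · refine lt_of_le_of_lt (iSup₂_le fun g hg => ENNReal.ofReal_le_ofReal ?_)
      (ENNReal.ofReal_lt_top (r := d * (C * μ.real Set.univ)))
    change T.mollify ν (DForm.dCLM d 0 g) ≤ _
    rw [mollify_apply]
    refine (le_abs_self _).trans (hT.abs_pairing_le fun k x => ?_)
    simp_rw [average_apply, DForm.coeff_dCLM_zero]
    simpa using hC g.toFunction g.contDiff_toFunction g.hasCompactSupport_toFunction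
      (fun x => (g.abs_toFunction_le x).trans (hg x)) x (EuclideanSpace.single k 1)

/-- On a form with `‖ω‖ ≤ 1` and `‖dω‖ ≤ 1`, the difference between the mollified current and the
original one is `T(1, π)`, with `π` uniformly small and `3`-Lipschitz, up to a small error. -/
theorem exists_abs_mollify_sub_le {T : MetricOneCurrent (EuclideanSpace ℝ (Fin d))}
    {μ : Measure (EuclideanSpace ℝ (Fin d))} [IsFiniteMeasure μ] (hT : T.IsMassBound μ)
    {ν : Measure (EuclideanSpace ℝ (Fin d))} [IsProbabilityMeasure ν] {ε : ℝ} (hε : ε ≤ 1)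
    (hν : ∀ᵐ y ∂ν, ‖y‖ ≤ ε) {ω : DForm d 1} (hω : ∀ x, ‖ω x‖ ≤ 1)
    (hdω : ∀ x, ‖DForm.dCLM d 1 ω x‖ ≤ 1) :
    ∃ π : LipFun (EuclideanSpace ℝ (Fin d)),
      LipschitzWith 3 (π : EuclideanSpace ℝ (Fin d) → ℝ) ∧
      (∀ x, |(π : EuclideanSpace ℝ (Fin d) → ℝ) x| ≤ ε) ∧
      |(T.mollify ν - T.toDeRham) ω - T.toBilin (one _) π| ≤ d * (ε * μ.real Set.univ) := by
  obtain ⟨p, G, hG, hGc, hp, hpε, hGε⟩ := exists_potential ω.contDiff_toDual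
    ω.hasCompactSupport_toDual (a := 1) (b := 1) (fun x => (ω.norm_toDual x).trans_le (hω x))
    (fun x => DForm.abs_fderiv_toDual_sub_le (hdω x)) hν
  simp only [one_mul] at hpε hGε
  have hω' : ∀ x v, |ω.toDual x v| ≤ ‖v‖ := fun x v => by
    refine ((ω.toDual x).le_opNorm v).trans (mul_le_of_le_one_left (norm_nonneg _) ?_)
    exact (ω.norm_toDual x).trans_le (hω x)
  have hG3 : ∀ x, ‖G x‖ ≤ 3 := fun x => by
    refine ContinuousLinearMap.opNorm_le_bound _ (by norm_num) fun v => ?_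
    have h1 : |∫ y, ω.toDual (x + y) v ∂ν| ≤ ‖v‖ := by
      have := norm_integral_le_of_norm_le_const (μ := ν) (f := fun y => ω.toDual (x + y) v)
        (Eventually.of_forall fun y => hω' (x + y) v)
      rwa [probReal_univ, mul_one] at this
    have h2 : ‖v‖ * ε ≤ ‖v‖ := mul_le_of_le_one_right (norm_nonneg _) hε
    have h3 := abs_le.1 (hGε x v)
    have h4 := abs_le.1 h1
    have h5 := abs_le.1 (hω' x v)
    rw [Real.norm_eq_abs, abs_le]
    constructor <;> linarith
  have hlip : LipschitzWith 3 p := lipschitzOnWith_univ.1 <|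
    convex_univ.lipschitzOnWith_of_nnnorm_hasFDerivWithin_le
      (fun x _ => (hG x).hasFDerivWithinAt) fun x _ => hG3 x
  refine ⟨⟨p, 3, hlip⟩, hlip, hpε, ?_⟩
  let a : Fin d → BoundedBorel (EuclideanSpace ℝ (Fin d)) := fun k =>
    ⟨fun x => G x (EuclideanSpace.single k 1),
      (hGc.clm_apply continuous_const).measurable, 3, fun x =>
        ((G x).le_opNorm _).trans (by simpa using hG3 x)⟩
  rw [T.toBilin_one_eq_pairing (a := a) hG hGc hp fun k x => rfl, sub_apply,
    mollify_apply, toDeRham_eq_pairing, ← map_sub, ← map_sub]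
  refine hT.abs_pairing_le fun k x => ?_
  change |∫ y, ω.toDual (x + y) (EuclideanSpace.single k 1) ∂ν -
    ω.toDual x (EuclideanSpace.single k 1) - G x (EuclideanSpace.single k 1)| ≤ ε
  rw [abs_sub_comm]
  simpa using hGε x (EuclideanSpace.single k 1)

/-- Mollification at a small scale changes `T` little in the flat norm. -/
theorem exists_flatNorm_mollify_sub_le (T : MetricOneCurrent (EuclideanSpace ℝ (Fin d))) {η : ℝ}
    (hη : 0 < η) : ∃ δ > 0, ∀ (ν : Measure (EuclideanSpace ℝ (Fin d))) [IsProbabilityMeasure ν],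
      (∀ᵐ y ∂ν, ‖y‖ ≤ δ) →
        DRCurrent.flatNorm (T.mollify ν - T.toDeRham) ≤ ENNReal.ofReal η := by
  obtain ⟨μ, hμ, hT⟩ := T.finite_mass
  replace hT : T.IsMassBound μ := hT
  obtain ⟨δ, hδ, hδT⟩ := T.exists_forall_abs_le (one _) 3 (half_pos hη)
  set M : ℝ := d * μ.real Set.univ with hM
  have hM0 : 0 ≤ M := by positivity
  refine ⟨min (min δ 1) (η / 2 / (M + 1)), by positivity, fun ν _ hν => ?_⟩
  refine iSup₂_le fun ω hω => ENNReal.ofReal_le_ofReal ?_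
  obtain ⟨π, hπ, hπε, h⟩ := exists_abs_mollify_sub_le hT
    ((min_le_left _ _).trans (min_le_right _ _)) hν (fun x => (hω x).1) fun x => (hω x).2
  have h1 := hδT π hπ fun x => (hπε x).trans ((min_le_left _ _).trans (min_le_left _ _))
  have h2 : d * (min (min δ 1) (η / 2 / (M + 1)) * μ.real Set.univ) ≤ η / 2 := by
    calc _ = min (min δ 1) (η / 2 / (M + 1)) * M := by rw [hM]; ring
      _ ≤ η / 2 / (M + 1) * (M + 1) :=
        mul_le_mul (min_le_right _ _) (by linarith) hM0 (by positivity)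
      _ = η / 2 := div_mul_cancel₀ _ (by positivity)
  have h3 := (abs_le.1 (h.trans h2)).2
  have h4 := (abs_le.1 h1).2
  linarith

end MetricOneCurrent

theorem theorem1 (d : ℕ) (T : MetricOneCurrent (EuclideanSpace ℝ (Fin d))) :
    DRCurrent.IsFlatChain T.toDeRham ∧ DRCurrent.mass T.toDeRham < ∞ := by
  refine ⟨?_, T.mass_toDeRham_lt_top⟩
  choose δ hδ hδT using fun n : ℕ => T.exists_flatNorm_mollify_sub_le (η := 1 / ((n : ℝ) + 1))
    Nat.one_div_pos_of_nat
  choose ν hν hνδ C hC using fun n => exists_smoothing_measure (EuclideanSpace ℝ (Fin d)) (hδ n)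
  refine ⟨fun n => T.mollify (ν n), fun n => T.isNormal_mollify (hC n), ?_⟩
  refine tendsto_of_tendsto_of_tendsto_of_le_of_le tendsto_const_nhds ?_ (fun _ => zero_le)
    fun n => hδT n (ν n) (hνδ n)
  simpa using ENNReal.tendsto_ofReal tendsto_one_div_add_atTop_nhds_zero_nat
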